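/- Let $n\in\mathbb N$, $\hbar\in(0,1]$, $\hbar\mathbb Z^n=\{\hbar l: l\in\mathbb Z^n\}\subset\mathbb R^n$, $\mathbb T^n=\mathbb R^n/\mathbb Z^n$ with Haar measure of total mass $1$, and let $|k|$ denote the Euclidean norm of $k\in\hbar\mathbb Z^n$. Let $v_j$ be the $j$-th standard basis vector and, for multi-indices $\alpha,\beta\in\mathbb N_0^n$, put $$\Delta_{\hbar,j}g(k)=\frac{g(k+\hbar v_j)-g(k)}{\hbar},\qquad \Delta_\hbar^\alpha=\Delta_{\hbar,1}^{\alpha_1}\cdots\Delta_{\hbar,n}^{\alpha_n},\qquad D_{\hbar,\theta}^{(\beta)}=\hbar^{|\beta|}\prod_{j=1}^n\prod_{\ell=0}^{\beta_j-1}\Big(\frac1{2\pi i}\frac{\partial}{\partial\theta_j}-\ell\Big).$$ Let $r\in\mathbb R$ and let $\sigma_\hbar\in S^r_{0,0}(\hbar\mathbb Z^n\times\mathbb T^n)$, that is, $\sigma_\hbar:\hbar\mathbb Z^n\times\mathbb T^n\to\mathbb C$ is such that $\sigma_\hbar(k,\cdot)\in C^\infty(\mathbb T^n)$ for every $k$,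 and for all $\alpha,\beta\in\mathbb N_0^n$ there is $C_{\alpha,\beta}>0$ with $$|D_{\hbar,\theta}^{(\beta)}\Delta_{\hbar,k}^{\alpha}\sigma_\hbar(k,\theta)|\le C_{\alpha,\beta}(1+|k|)^{r}\qquad\text{for all }k\in\hbar\mathbb Z^n,\ \theta\in\mathbb T^n .$$ For $s\in\mathbb R$ let $\ell^2_s(\hbar\mathbb Z^n)$ be the space of all $f:\hbar\mathbb Z^n\to\mathbb C$ with $\|f\|_{\ell^2_s}:=\big(\sum_{k}(1+|k|)^{2s}|f(k)|^2\big)^{1/2}<\infty$. Let $$\mathrm{Op}(\sigma_\hbar)f(k)=\int_{\mathbb T^n}e^{2\pi\frac i\hbar k\cdot\theta}\sigma_\hbar(k,\theta)\widehat f(\theta)\,d\theta,\qquad \widehat f(\theta)=\sum_{m\in\hbar\mathbb Z^n}e^{-2\pi\frac i\hbar m\cdot\theta}f(m),$$ for $f\in\ell^1(\hbar\mathbb Z^n)$; for general $f\in\ell^2_s(\hbar\mathbb Z^n)$ the integral is understood as the distributional pairing of $\widehat f$ with $e^{2\pi\frac i\hbar k\cdot\theta}\sigma_\hbar(k,\theta)$,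 i.e. $$\mathrm{Op}(\sigma_\hbar)f(k)=\sum_{m\in\hbar\mathbb Z^n}f(m)\int_{\mathbb T^n}e^{-2\pi\frac i\hbar m\cdot\theta}\,e^{2\pi\frac i\hbar k\cdot\theta}\sigma_\hbar(k,\theta)\,d\theta .$$ Then, for every $s\in\mathbb R$: this series converges absolutely for all $f\in\ell^2_s(\hbar\mathbb Z^n)$ and $k\in\hbar\mathbb Z^n$; for $f\in\ell^1(\hbar\mathbb Z^n)$ the integral defining $\mathrm{Op}(\sigma_\hbar)f(k)$ converges absolutely and equals the series; and $\mathrm{Op}(\sigma_\hbar)$ is a bounded linear operator from $\ell^2_s(\hbar\mathbb Z^n)$ to $\ell^2_{s-r}(\hbar\mathbb Z^n)$, i.e. there is a constant $C$ with $\|\mathrm{Op}(\sigma_\hbar)f\|_{\ell^2_{s-r}}\le C\|f\|_{\ell^2_s}$ for all $f\in\ell^2_s(\hbar\mathbb Z^n)$. -/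

import Mathlib

open MeasureTheory

noncomputable section

/-- The lattice `ħℤⁿ = {x ∈ ℝⁿ : x = ħ l, l ∈ ℤⁿ}`, an additive subgroup of Euclidean space, so that
`‖k‖` is the Euclidean length `|k| = ħ (∑ lⱼ²)^{1/2}`. -/
def ScaledLattice (n : ℕ) (h : ℝ) : AddSubgroup (EuclideanSpace ℝ (Fin n)) where
  carrier := {x | ∃ l : Fin n → ℤ, ∀ i, x i = h * (l i : ℝ)}
  zero_mem' := ⟨0, fun i => by simp⟩
  add_mem' := by
    rintro x y ⟨l, hl⟩ ⟨m, hm⟩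
    exact ⟨l + m, fun i => by simp [hl i, hm i, mul_add]⟩
  neg_mem' := by
    rintro x ⟨l, hl⟩
    exact ⟨-l, fun i => by simp [hl i]⟩

namespace ScaledLattice

variable {n : ℕ} {h : ℝ}

/-- The integer coordinates `l` of a lattice point `k = ħ l` (unique when `ħ ≠ 0`). -/
def coord (k : ScaledLattice n h) : Fin n → ℤ := k.2.choose

theorem coord_spec (k : ScaledLattice n h) (i : Fin n) :
    (k : EuclideanSpace ℝ (Fin n)) i = h * (coord k i : ℝ) := k.2.choose_spec i

/-- The character `e^{2π (i/ħ) k·θ}` of the torus `𝕋ⁿ = ℝⁿ/ℤⁿ` attached to a lattice point `k`. -/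
def char (k : ScaledLattice n h) (θ : UnitAddTorus (Fin n)) : ℂ :=
  UnitAddTorus.mFourier (coord k) θ

/-- `char` is the exponential `e^{2π (i/ħ) k·x}`, where `k·x = ∑ⱼ kⱼ xⱼ`. -/
theorem char_coe (hh : h ≠ 0) (k : ScaledLattice n h) (x : Fin n → ℝ) :
    char k (fun i => (x i : UnitAddCircle)) =
      Complex.exp (2 * Real.pi * (Complex.I / h) *
        ∑ i, (((k : EuclideanSpace ℝ (Fin n)) i * x i : ℝ) : ℂ)) := by
  have hc : (h : ℂ) ≠ 0 := by exact_mod_cast hh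
  simp only [char, UnitAddTorus.mFourier, ContinuousMap.coe_mk, fourier_coe_apply]
  rw [← Complex.exp_sum, Finset.mul_sum]
  congr 1
  refine Finset.sum_congr rfl fun i _ => ?_
  rw [coord_spec]
  push_cast
  field_simp

/-- The lattice point `ħ vⱼ`, with `vⱼ` the `j`-th standard basis vector. -/
def step (h : ℝ) (j : Fin n) : ScaledLattice n h :=
  ⟨EuclideanSpace.single j h, Pi.single j 1, fun i => by
    by_cases hij : i = j
    · subst hij; simp
    · simp [hij]⟩

/-- The difference operator `Δ_{ħ,j} g(k) = (g(k + ħ vⱼ) - g(k)) / ħ`. -/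
def diff (j : Fin n) (g : ScaledLattice n h → ℂ) : ScaledLattice n h → ℂ :=
  fun k => (g (k + step h j) - g k) / (h : ℂ)

/-- `Δ_ħ^α = Δ_{ħ,1}^{α₁} ⋯ Δ_{ħ,n}^{αₙ}`. -/
def multiDiff (α : Fin n → ℕ) (g : ScaledLattice n h → ℂ) : ScaledLattice n h → ℂ :=
  (List.finRange n).foldr (fun j G => (diff j)^[α j] G) g

end ScaledLattice

namespace SemiTorus

variable {n : ℕ}

/-- Smoothness of a function on `𝕋ⁿ = ℝⁿ/ℤⁿ`: its periodic lift to `ℝⁿ` is `C^∞`. -/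
def Smooth (g : UnitAddTorus (Fin n) → ℂ) : Prop :=
  ContDiff ℝ (⊤ : ℕ∞) (fun x : Fin n → ℝ => g (fun i => (x i : UnitAddCircle)))

/-- The partial derivative `∂/∂θⱼ` of a function on the torus. -/
def pderiv (j : Fin n) (g : UnitAddTorus (Fin n) → ℂ) : UnitAddTorus (Fin n) → ℂ :=
  fun θ => deriv (fun t : ℝ => g (θ + Pi.single j (t : UnitAddCircle))) 0

/-- `D_{ħ,θⱼ}^{(b)} = ħ^b ∏_{ℓ=0}^{b-1} ((1/(2πi)) ∂/∂θⱼ - ℓ)`. -/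
def D (h : ℝ) (j : Fin n) : ℕ → (UnitAddTorus (Fin n) → ℂ) → (UnitAddTorus (Fin n) → ℂ)
  | 0, g => g
  | b + 1, g => fun θ =>
      (h : ℂ) * (1 / (2 * Real.pi * Complex.I) * pderiv j (D h j b g) θ - (b : ℂ) * D h j b g θ)

/-- `D_{ħ,θ}^{(β)} = D_{ħ,θ₁}^{(β₁)} ⋯ D_{ħ,θₙ}^{(βₙ)}`. -/
def multiD (h : ℝ) (β : Fin n → ℕ) (g : UnitAddTorus (Fin n) → ℂ) : UnitAddTorus (Fin n) → ℂ :=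
  (List.finRange n).foldr (fun j G => D h j (β j) G) g

end SemiTorus

/-- The Haar measure of total mass one on `𝕋ⁿ = ℝⁿ/ℤⁿ`. -/
def torusMeasure (n : ℕ) : Measure (UnitAddTorus (Fin n)) :=
  Measure.pi fun _ => (AddCircle.haarAddCircle : Measure UnitAddCircle)

/-- The symbol class `S^μ_{ρ,δ}(ħℤⁿ × 𝕋ⁿ)`. -/
structure IsLatticeSymbol {n : ℕ} {h : ℝ} (μ ρ δ : ℝ)
    (σ : ScaledLattice n h → UnitAddTorus (Fin n) → ℂ) : Prop where
  smooth : ∀ k, SemiTorus.Smooth (σ k)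
  bound : ∀ α β : Fin n → ℕ, ∃ C : ℝ, 0 < C ∧ ∀ k θ,
    ‖SemiTorus.multiD h β (fun ω => ScaledLattice.multiDiff α (fun x => σ x ω) k) θ‖ ≤
      C * (1 + ‖k‖) ^ (μ - ρ * (∑ i, α i : ℕ) + δ * (∑ i, β i : ℕ))

/-- The Fourier transform `f̂(θ) = ∑_{k ∈ ħℤⁿ} e^{-2π (i/ħ) k·θ} f(k)` of `f ∈ ℓ¹(ħℤⁿ)`. -/
def latticeFourier {n : ℕ} {h : ℝ} (f : ScaledLattice n h → ℂ) (θ : UnitAddTorus (Fin n)) : ℂ :=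
  ∑' k, ScaledLattice.char (-k) θ * f k

/-- The quantization on `ℓ¹(ħℤⁿ)`:
`Op(σ)f(k) = ∫_{𝕋ⁿ} e^{2π (i/ħ) k·θ} σ(k,θ) f̂(θ) dθ` (Haar measure of total mass one). -/
def latticeOpInt {n : ℕ} {h : ℝ} (σ : ScaledLattice n h → UnitAddTorus (Fin n) → ℂ)
    (f : ScaledLattice n h → ℂ) (k : ScaledLattice n h) : ℂ :=
  ∫ θ, ScaledLattice.char k θ * σ k θ * latticeFourier f θ ∂(torusMeasure n)

/-- The terms of the pairing `⟨f̂, φ⟩ = ∑_m f(m) ∫_{𝕋ⁿ} e^{-2π (i/ħ) m·θ} φ(θ) dθ` of the Fourier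
transform of a tempered `f`, a distribution on the torus, with a smooth function `φ`. -/
def latticePairingTerm {n : ℕ} {h : ℝ} (f : ScaledLattice n h → ℂ)
    (φ : UnitAddTorus (Fin n) → ℂ) (m : ScaledLattice n h) : ℂ :=
  f m * ∫ θ, ScaledLattice.char (-m) θ * φ θ ∂(torusMeasure n)

/-- The quantization on tempered `f`: `Op(σ)f(k) = ⟨f̂, e^{2π (i/ħ) k·θ} σ(k,θ)⟩`, which is the
integral `∫ e^{2π (i/ħ) k·θ} σ(k,θ) f̂(θ) dθ` in the sense of distributions on the torus. -/
def latticeOp {n : ℕ} {h : ℝ} (σ : ScaledLattice n h → UnitAddTorus (Fin n) → ℂ)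
    (f : ScaledLattice n h → ℂ) (k : ScaledLattice n h) : ℂ :=
  ∑' m, latticePairingTerm f (fun θ => ScaledLattice.char k θ * σ k θ) m

/-- The weighted space `ℓ²_s(ħℤⁿ)`: all `f` with `∑_k (1 + |k|)^{2s} |f(k)|² < ∞`. -/
def weightedL2 (n : ℕ) (h s : ℝ) : Submodule ℂ (ScaledLattice n h → ℂ) where
  carrier := {f | Summable fun k => (1 + ‖k‖) ^ (2 * s) * ‖f k‖ ^ 2}
  zero_mem' := by simp
  add_mem' := by
    intro f g hf hg
    refine Summable.of_nonneg_of_le (fun k => by positivity) (fun k => ?_)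
      ((hf.mul_left 2).add (hg.mul_left 2))
    have hw : 0 ≤ (1 + ‖k‖) ^ (2 * s) := by positivity
    have h1 : ‖(f + g) k‖ ^ 2 ≤ 2 * ‖f k‖ ^ 2 + 2 * ‖g k‖ ^ 2 := by
      have := norm_add_le (f k) (g k)
      have h2 : ‖(f + g) k‖ ^ 2 ≤ (‖f k‖ + ‖g k‖) ^ 2 :=
        pow_le_pow_left₀ (norm_nonneg _) this 2
      nlinarith [sq_nonneg (‖f k‖ - ‖g k‖)]
    nlinarith [mul_le_mul_of_nonneg_left h1 hw]
  smul_mem' := by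
    intro c f hf
    refine (hf.mul_left (‖c‖ ^ 2)).congr fun k => ?_
    simp only [Pi.smul_apply, smul_eq_mul, norm_mul]
    ring

/-- The norm `‖f‖_{ℓ²_s} = (∑_k (1 + |k|)^{2s} |f(k)|²)^{1/2}`. -/
def weightedL2Norm {n : ℕ} {h : ℝ} (s : ℝ) (f : ScaledLattice n h → ℂ) : ℝ :=
  Real.sqrt (∑' k, (1 + ‖k‖) ^ (2 * s) * ‖f k‖ ^ 2)

end

/-! The operator `Op(σ)` is an infinite matrix whose entry `K(k,m)` is, up to sign of the frequency,
the Fourier coefficient of `σ(k,·)` at `(k - m)/ħ`. Smoothness in `θ` makes it decay off the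
diagonal: integration by parts trades powers of `|k_j - m_j|` for operators `D^{(b)}` in `θ_j`.
Since `ρ = δ = 0`, every order costs the same weight, so `|K(k,m)| ≤ C_N (1+|k|)^r (1+|k-m|)^{-N}`
for every `N` (`exists_moment_bound`, `exists_kernel_bound`). Only `α = 0` and derivatives along a
single axis are needed.

Peetre's inequality (`one_add_norm_rpow_le`) moves the weight from `k` to `m` at the price of
`(1+|k-m|)^{|s|}`, which the decay absorbs. The weighted matrix is then dominated by convolution
with an `ℓ¹` function (`exists_conv_bound`), and Young's inequality `ℓ¹ * ℓ² ⊆ ℓ²` gives convergence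
and boundedness together. For `f ∈ ℓ¹`, Fubini identifies the series with the integral. -/

noncomputable section

/-! ### Calculus and integration by parts on the torus -/

namespace SemiTorus

variable {n : ℕ}

/-- The covering map `ℝⁿ → 𝕋ⁿ`. -/
def cover (x : Fin n → ℝ) : UnitAddTorus (Fin n) := fun i => (x i : UnitAddCircle)

theorem isOpenQuotientMap_cover : IsOpenQuotientMap (cover (n := n)) :=
  IsOpenQuotientMap.piMap fun _ => QuotientAddGroup.isOpenQuotientMap_mk

theorem cover_add_single (x : Fin n → ℝ) (j : Fin n) (t : ℝ) :
    cover x + Pi.single j (t : UnitAddCircle) = cover (x + t • Pi.single j 1) := by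
  funext i
  by_cases hij : i = j
  · subst hij; simp [cover]
  · simp [cover, hij]

theorem Smooth.continuous {g : UnitAddTorus (Fin n) → ℂ} (hg : Smooth g) : Continuous g :=
  isOpenQuotientMap_cover.continuous_comp_iff.1 (ContDiff.continuous hg)

/-- Translations along one axis compose additively, so the derivative at `0` that defines `pderiv`
also gives the derivative at any time `t`; differentiability comes from the lift to `ℝⁿ`. -/
theorem Smooth.hasDerivAt_add_single {g : UnitAddTorus (Fin n) → ℂ} (hg : Smooth g) (j : Fin n)
    (θ : UnitAddTorus (Fin n)) (t : ℝ) :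
    HasDerivAt (fun t : ℝ => g (θ + Pi.single j (t : UnitAddCircle)))
      (pderiv j g (θ + Pi.single j (t : UnitAddCircle))) t := by
  obtain ⟨x, rfl⟩ := isOpenQuotientMap_cover.surjective θ
  have key : DifferentiableAt ℝ
      (fun t : ℝ => g (cover x + Pi.single j (t : UnitAddCircle))) t := by
    simp_rw [cover_add_single]
    have h1 : Differentiable ℝ (fun y : Fin n → ℝ => g (cover y)) :=
      ContDiff.differentiable hg (by simp)
    exact (h1 _).comp (f := fun t : ℝ => x + t • (Pi.single j 1 : Fin n → ℝ)) t (by fun_prop)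
  have h2 := key.hasDerivAt
  suffices h4 : SemiTorus.pderiv j g (cover x + Pi.single j (t : UnitAddCircle)) =
      deriv (fun t : ℝ => g (cover x + Pi.single j (t : UnitAddCircle))) t by rwa [h4]
  unfold SemiTorus.pderiv
  have h3 : (fun u : ℝ => g (cover x + Pi.single j (t : UnitAddCircle) +
      Pi.single j (u : UnitAddCircle))) =
      fun u : ℝ => (fun t : ℝ => g (cover x + Pi.single j (t : UnitAddCircle))) (t + u) := by
    funext u
    simp only [add_assoc, ← Pi.single_add, AddCircle.coe_add]
  rw [h3]
  exact (deriv_comp_const_add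
    (fun t : ℝ => g (cover x + Pi.single j (t : UnitAddCircle))) t 0).trans (by rw [add_zero])

theorem Smooth.pderiv {g : UnitAddTorus (Fin n) → ℂ} (hg : Smooth g) (j : Fin n) :
    Smooth (pderiv j g) := by
  have h1 : Differentiable ℝ (fun y : Fin n → ℝ => g (cover y)) :=
    ContDiff.differentiable hg (by simp)
  have h2 : (fun x : Fin n → ℝ => SemiTorus.pderiv j g (cover x)) =
      fun x => fderiv ℝ (fun y : Fin n → ℝ => g (cover y)) x (Pi.single j 1) := by
    funext x
    unfold SemiTorus.pderiv
    simp_rw [cover_add_single]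
    exact ((h1 x).lineDeriv_eq_fderiv : lineDeriv ℝ _ x (Pi.single j 1) = _)
  change ContDiff ℝ _ (fun x : Fin n → ℝ => SemiTorus.pderiv j g (cover x))
  rw [h2]
  exact ContDiff.clm_apply (ContDiff.fderiv_right hg (by simp)) contDiff_const

theorem Smooth.mul {f g : UnitAddTorus (Fin n) → ℂ} (hf : Smooth f) (hg : Smooth g) :
    Smooth (fun θ => f θ * g θ) :=
  ContDiff.mul hf hg

theorem Smooth.D {g : UnitAddTorus (Fin n) → ℂ} (hg : Smooth g) (h : ℝ) (j : Fin n) (b : ℕ) :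
    Smooth (D h j b g) := by
  induction b with
  | zero => exact hg
  | succ b ih =>
    have h1 := ih.pderiv j
    unfold Smooth at ih h1 ⊢
    simp only [SemiTorus.D]
    fun_prop

theorem pderiv_mul {f g : UnitAddTorus (Fin n) → ℂ} (hf : Smooth f) (hg : Smooth g) (j : Fin n)
    (θ : UnitAddTorus (Fin n)) :
    pderiv j (fun θ => f θ * g θ) θ = pderiv j f θ * g θ + f θ * pderiv j g θ := by
  have h1 := (hf.hasDerivAt_add_single j θ 0).mul (hg.hasDerivAt_add_single j θ 0)
  have h2 : pderiv j (fun θ => f θ * g θ) θ = _ := h1.deriv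
  simpa using h2

theorem mFourier_add_single (l : Fin n → ℤ) (θ : UnitAddTorus (Fin n)) (j : Fin n)
    (t : UnitAddCircle) :
    UnitAddTorus.mFourier l (θ + Pi.single j t) = fourier (l j) t * UnitAddTorus.mFourier l θ := by
  have h1 : ∏ i, fourier (l i) ((Pi.single j t : UnitAddTorus (Fin n)) i) = fourier (l j) t := by
    rw [Finset.prod_eq_single j]
    · simp
    · intro i _ hij
      simp [hij]
    · simp
  simp only [UnitAddTorus.mFourier, ContinuousMap.coe_mk, Pi.add_apply]
  rw [← h1, ← Finset.prod_mul_distrib]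
  refine Finset.prod_congr rfl fun i _ => ?_
  simp only [fourier_apply, smul_add, AddCircle.toCircle_add, Circle.coe_mul]
  ring

theorem smooth_mFourier (l : Fin n → ℤ) : Smooth (UnitAddTorus.mFourier l) := by
  unfold Smooth
  simp only [UnitAddTorus.mFourier, ContinuousMap.coe_mk, fourier_coe_apply]
  have h1 : ∀ i, ContDiff ℝ (⊤ : ℕ∞) fun x : Fin n → ℝ => (x i : ℂ) := fun i =>
    Complex.ofRealCLM.contDiff.comp (contDiff_apply ℝ ℝ i)
  fun_prop

theorem pderiv_mFourier (l : Fin n → ℤ) (j : Fin n) (θ : UnitAddTorus (Fin n)) :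
    pderiv j (UnitAddTorus.mFourier l) θ =
      2 * Real.pi * Complex.I * l j * UnitAddTorus.mFourier l θ := by
  unfold pderiv
  simp_rw [mFourier_add_single]
  have h1 := (hasDerivAt_fourier 1 (l j) 0).mul_const (UnitAddTorus.mFourier l θ)
  rw [h1.deriv]
  simp

instance : IsProbabilityMeasure (torusMeasure n) := by
  unfold torusMeasure; infer_instance

instance : (torusMeasure n).IsAddLeftInvariant := by
  unfold torusMeasure; infer_instance

theorem integrable_of_continuous {g : UnitAddTorus (Fin n) → ℂ} (hg : Continuous g) :
    Integrable g (torusMeasure n) :=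
  hg.integrable_of_hasCompactSupport (HasCompactSupport.of_compactSpace g)

/-- The derivative of a function along a curve of translations has integral zero. -/
theorem _root_.integral_eq_zero_of_hasDerivAt_translate {G : Type*} [AddCommGroup G]
    [TopologicalSpace G] [IsTopologicalAddGroup G] [CompactSpace G] [MeasurableSpace G]
    [BorelSpace G] {μ : Measure G} [IsFiniteMeasure μ] [μ.IsAddLeftInvariant] {c : ℝ → G}
    {g g' : G → ℂ} (hg : Continuous g) (hg' : Continuous g')
    (hd : ∀ x t, HasDerivAt (fun t => g (x + c t)) (g' (x + c t)) t) :
    ∫ x, g' x ∂μ = 0 := by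
  obtain ⟨B, hB⟩ := isCompact_univ.exists_bound_of_continuousOn hg'.continuousOn
  have hint : ∀ {u : G → ℂ}, Continuous u → Integrable u μ := fun hu =>
    hu.integrable_of_hasCompactSupport (HasCompactSupport.of_compactSpace _)
  have hshift : ∀ t : ℝ, Continuous fun x : G => x + c t := fun t =>
    continuous_id.add continuous_const
  have i1 : ∀ t : ℝ, Integrable (fun x => g (x + c t)) μ := fun t => hint (hg.comp (hshift t))
  have i2 : ∀ t : ℝ, Integrable (fun x => g' (x + c t)) μ := fun t =>
    hint (hg'.comp (hshift t))
  have h1 := (hasDerivAt_integral_of_dominated_loc_of_deriv_le (μ := μ)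
    (F := fun (t : ℝ) x => g (x + c t)) (F' := fun (t : ℝ) x => g' (x + c t))
    (x₀ := 0) (s := Set.univ) (bound := fun _ => B) Filter.univ_mem
    (Filter.Eventually.of_forall fun t => (i1 t).aestronglyMeasurable)
    (i1 0) (i2 0).aestronglyMeasurable
    (Filter.Eventually.of_forall fun x t _ => hB _ (Set.mem_univ _))
    (integrable_const _)
    (Filter.Eventually.of_forall fun x t _ => hd x t)).2
  -- By invariance of `μ` the integral does not depend on `t`, so its derivative, the integral of
  -- `g'`, vanishes.
  have h2 : (fun t : ℝ => ∫ x, g (x + c t) ∂μ) = fun _ => ∫ x, g x ∂μ :=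
    funext fun t => integral_add_right_eq_self g (c t)
  rw [h2, integral_add_right_eq_self g' (c 0)] at h1
  exact h1.unique (hasDerivAt_const 0 _)

theorem integral_pderiv {g : UnitAddTorus (Fin n) → ℂ} (hg : Smooth g) (j : Fin n) :
    ∫ θ, pderiv j g θ ∂(torusMeasure n) = 0 :=
  integral_eq_zero_of_hasDerivAt_translate hg.continuous (hg.pderiv j).continuous
    fun θ t => hg.hasDerivAt_add_single j θ t

/-- Integration by parts: the derivative of the product has mean zero, and the character is an
eigenfunction of the derivative. -/
theorem integral_mFourier_mul_pderiv {g : UnitAddTorus (Fin n) → ℂ} (hg : Smooth g) (j : Fin n)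
    (l : Fin n → ℤ) :
    ∫ θ, UnitAddTorus.mFourier l θ * pderiv j g θ ∂(torusMeasure n) =
      -(2 * Real.pi * Complex.I * l j) *
        ∫ θ, UnitAddTorus.mFourier l θ * g θ ∂(torusMeasure n) := by
  have h1 := integral_pderiv ((smooth_mFourier l).mul hg) j
  have hc : Continuous fun θ => UnitAddTorus.mFourier l θ := map_continuous _
  have i1 : Integrable (fun θ => UnitAddTorus.mFourier l θ * g θ) (torusMeasure n) :=
    integrable_of_continuous (hc.mul hg.continuous)
  have i2 : Integrable (fun θ => UnitAddTorus.mFourier l θ * pderiv j g θ) (torusMeasure n) :=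
    integrable_of_continuous (hc.mul (hg.pderiv j).continuous)
  have h2 : ∀ θ, pderiv j (fun θ => UnitAddTorus.mFourier l θ * g θ) θ =
      2 * Real.pi * Complex.I * l j * (UnitAddTorus.mFourier l θ * g θ) +
        UnitAddTorus.mFourier l θ * pderiv j g θ := fun θ => by
    rw [pderiv_mul (smooth_mFourier l) hg, pderiv_mFourier, mul_assoc _ _ (g θ)]
  simp_rw [h2] at h1
  rw [integral_add (i1.const_mul _) i2, integral_const_mul] at h1
  linear_combination h1

theorem integral_mFourier_mul_D_succ {g : UnitAddTorus (Fin n) → ℂ} (hg : Smooth g) (h : ℝ)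
    (j : Fin n) (b : ℕ) (l : Fin n → ℤ) :
    ∫ θ, UnitAddTorus.mFourier l θ * D h j (b + 1) g θ ∂(torusMeasure n) =
      -(h * l j + h * b) *
        ∫ θ, UnitAddTorus.mFourier l θ * D h j b g θ ∂(torusMeasure n) := by
  have hD := hg.D h j b
  have hc : Continuous fun θ => UnitAddTorus.mFourier l θ := map_continuous _
  have i1 : Integrable (fun θ => UnitAddTorus.mFourier l θ * D h j b g θ) (torusMeasure n) :=
    integrable_of_continuous (hc.mul hD.continuous)
  have i2 : Integrable (fun θ => UnitAddTorus.mFourier l θ * pderiv j (D h j b g) θ)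
      (torusMeasure n) := integrable_of_continuous (hc.mul (hD.pderiv j).continuous)
  have h1 : ∀ θ, UnitAddTorus.mFourier l θ * D h j (b + 1) g θ =
      h * (1 / (2 * Real.pi * Complex.I)) *
        (UnitAddTorus.mFourier l θ * pderiv j (D h j b g) θ) -
      h * b * (UnitAddTorus.mFourier l θ * D h j b g θ) := by
    intro θ
    simp only [D]
    ring
  simp_rw [h1]
  rw [integral_sub (i2.const_mul _) (i1.const_mul _), integral_const_mul, integral_const_mul,
    integral_mFourier_mul_pderiv hD]
  have hp : (Real.pi : ℂ) ≠ 0 := by exact_mod_cast Real.pi_ne_zero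
  field_simp
  ring

/-- Extracts from the symbol estimates the pure one-axis bounds, the only ones of positive order
used. The list of axes has no repetition, so `j` acts once and the other factors have order zero. -/
theorem multiD_single (h : ℝ) (j : Fin n) (b : ℕ) (g : UnitAddTorus (Fin n) → ℂ) :
    multiD h (Pi.single j b) g = D h j b g := by
  have key : ∀ L : List (Fin n), L.Nodup →
      L.foldr (fun i G => D h i ((Pi.single j b : Fin n → ℕ) i) G) g =
        if j ∈ L then D h j b g else g := by
    intro L
    induction L with
    | nil => simp
    | cons i L ih =>
      intro hL
      rw [List.nodup_cons] at hL
      rw [List.foldr_cons, ih hL.2]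
      by_cases hij : i = j
      · subst hij
        simp [hL.1]
      · simp [hij, Ne.symm hij, D]
  exact (key _ (List.nodup_finRange n)).trans (if_pos (List.mem_finRange j))

end SemiTorus

/-! ### Lattice characters, summability and weights -/

theorem ScaledLattice.multiDiff_zero {n : ℕ} {h : ℝ} (g : ScaledLattice n h → ℂ) :
    multiDiff 0 g = g := by
  have key : ∀ L : List (Fin n),
      L.foldr (fun j G => (diff j)^[(0 : Fin n → ℕ) j] G) g = g := by
    intro L
    induction L with
    | nil => rfl
    | cons i L ih => simp
  exact key _

namespace ScaledLattice

variable {n : ℕ} {h : ℝ}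

theorem coord_sub (hh : h ≠ 0) (k m : ScaledLattice n h) : coord (k - m) = coord k - coord m := by
  funext i
  have h1 := coord_spec (k - m) i
  rw [AddSubgroup.coe_sub, PiLp.sub_apply, coord_spec k, coord_spec m, ← mul_sub] at h1
  have h2 := mul_left_cancel₀ hh h1
  exact_mod_cast h2.symm

theorem char_mul_char_neg (hh : h ≠ 0) (k m : ScaledLattice n h) (θ : UnitAddTorus (Fin n)) :
    char (-m) θ * char k θ = UnitAddTorus.mFourier (coord (k - m)) θ := by
  have h0 : coord (0 : ScaledLattice n h) = 0 := by
    simpa using coord_sub hh (0 : ScaledLattice n h) 0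
  have h1 : coord (-m) = -coord m := by
    rw [← zero_sub m, coord_sub hh, h0, zero_sub]
  rw [char, char, ← UnitAddTorus.mFourier_add, coord_sub hh, h1]
  congr 2
  abel

theorem norm_char (k : ScaledLattice n h) (θ : UnitAddTorus (Fin n)) : ‖char k θ‖ = 1 := by
  simp only [char, UnitAddTorus.mFourier, ContinuousMap.coe_mk, fourier_apply, norm_prod,
    Circle.norm_coe, Finset.prod_const_one]

theorem coord_injective : Function.Injective (coord : ScaledLattice n h → Fin n → ℤ) :=
  fun k m hkm => Subtype.ext (PiLp.ext fun i => by rw [coord_spec, coord_spec, hkm])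

instance : Countable (ScaledLattice n h) := coord_injective.countable

theorem continuous_char (k : ScaledLattice n h) : Continuous (char k) :=
  map_continuous (UnitAddTorus.mFourier (coord k))

theorem le_norm_of_ne_zero (hh : 0 < h) (k : ScaledLattice n h) (hk : k ≠ 0) : h ≤ ‖k‖ := by
  obtain ⟨i, hi⟩ : ∃ i, coord k i ≠ 0 := by
    by_contra! hc
    refine hk (Subtype.ext (PiLp.ext fun i => ?_))
    rw [coord_spec k i, hc i]
    simp
  have h1 : (1 : ℝ) ≤ |(coord k i : ℝ)| := by exact_mod_cast Int.one_le_abs hi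
  have h2 : |(k : EuclideanSpace ℝ (Fin n)) i| ≤ ‖k‖ :=
    PiLp.norm_apply_le (k : EuclideanSpace ℝ (Fin n)) i
  rw [coord_spec, abs_mul, abs_of_pos hh] at h2
  nlinarith

theorem exists_summable_one_add_norm_inv_pow (n : ℕ) {h : ℝ} (hh : 0 < h) :
    ∃ N : ℕ, Summable fun k : ScaledLattice n h => (1 + ‖k‖)⁻¹ ^ N := by
  let L : Submodule ℤ (EuclideanSpace ℝ (Fin n)) := (ScaledLattice n h).toIntSubmodule
  have hd : DiscreteTopology L := by
    refine DiscreteTopology.of_forall_le_norm hh fun x hx => ?_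
    exact le_norm_of_ne_zero hh (⟨x.1, x.2⟩ : ScaledLattice n h) fun h0 =>
      hx (Subtype.ext (congrArg Subtype.val h0))
  refine ⟨Module.finrank ℤ L + 1, ?_⟩
  have h1 := ZLattice.summable_norm_pow_inv L (Module.finrank ℤ L + 1) (Nat.lt_succ_self _)
  have h2 : Summable fun k : ScaledLattice n h => ‖k‖⁻¹ ^ (Module.finrank ℤ L + 1) := h1
  -- The comparison fails at the origin, where `0⁻¹ = 0`, so it is made off a finite set.
  refine Summable.of_norm_bounded_eventually h2 ?_
  filter_upwards [(Set.finite_singleton (0 : ScaledLattice n h)).compl_mem_cofinite] with k hk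
  have hk' : 0 < ‖k‖ := lt_of_lt_of_le hh (le_norm_of_ne_zero hh k hk)
  rw [Real.norm_of_nonneg (by positivity)]
  gcongr
  linarith

theorem norm_le_sum_abs (k : ScaledLattice n h) :
    ‖k‖ ≤ ∑ i, |(k : EuclideanSpace ℝ (Fin n)) i| := by
  change ‖(k : EuclideanSpace ℝ (Fin n))‖ ≤ _
  have h1 : (k : EuclideanSpace ℝ (Fin n)) = ∑ i, EuclideanSpace.single i
      ((k : EuclideanSpace ℝ (Fin n)) i) := by
    ext j
    simp [Finset.sum_apply]
  conv_lhs => rw [h1]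
  refine (norm_sum_le _ _).trans (le_of_eq ?_)
  simp

/-- Decay in every coordinate gives decay in the norm. -/
theorem exists_pow_norm_le_sum (n : ℕ) (h : ℝ) (N : ℕ) :
    ∃ A : ℝ, 0 ≤ A ∧ ∀ k : ScaledLattice n h,
      (1 + ‖k‖) ^ N ≤ A * (1 + ∑ i, |(k : EuclideanSpace ℝ (Fin n)) i| ^ N) := by
  rcases N with _ | N
  · exact ⟨1, zero_le_one, fun k => by simp⟩
  -- Both factors come from convexity of `t ↦ t^(N+1)`: `2 ^ N` splits `1 + S`, and `n ^ N` splits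
  -- the sum `S` over the axes.
  refine ⟨2 ^ N * (1 + n ^ N), by positivity, fun k => ?_⟩
  set S := ∑ i, |(k : EuclideanSpace ℝ (Fin n)) i|
  set P := ∑ i, |(k : EuclideanSpace ℝ (Fin n)) i| ^ (N + 1)
  have hP : 0 ≤ P := by positivity
  have hS : 0 ≤ S := by positivity
  have h1 : S ^ (N + 1) ≤ n ^ N * P := by
    have h3 := pow_sum_le_card_mul_sum_pow (s := Finset.univ)
      (f := fun i => |(k : EuclideanSpace ℝ (Fin n)) i|) (fun i _ => abs_nonneg _) N
    simpa using h3
  have h2 : (1 + S) ^ (N + 1) ≤ 2 ^ N * (1 ^ (N + 1) + S ^ (N + 1)) :=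
    add_pow_le zero_le_one hS (N + 1)
  calc (1 + ‖k‖) ^ (N + 1) ≤ (1 + S) ^ (N + 1) := by
        gcongr
        exact norm_le_sum_abs k
    _ ≤ 2 ^ N * (1 + n ^ N * P) := by
        rw [one_pow] at h2
        exact h2.trans (by gcongr)
    _ ≤ 2 ^ N * (1 + n ^ N) * (1 + P) := by
        rw [mul_assoc]
        gcongr
        nlinarith [show (0 : ℝ) ≤ n ^ N by positivity]

/-- Peetre's inequality. For `s ≥ 0` it is a power of the triangle inequality; for `s ≤ 0` the roles
of `k` and `m` are exchanged and reciprocals taken. -/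
theorem one_add_norm_rpow_le (k m : ScaledLattice n h) (s : ℝ) :
    (1 + ‖k‖) ^ s ≤ (1 + ‖k - m‖) ^ |s| * (1 + ‖m‖) ^ s := by
  have h1 : 1 + ‖k‖ ≤ (1 + ‖k - m‖) * (1 + ‖m‖) := by
    have := norm_le_norm_sub_add k m
    nlinarith [norm_nonneg (k - m), norm_nonneg m]
  have h2 : 1 + ‖m‖ ≤ (1 + ‖k - m‖) * (1 + ‖k‖) := by
    have := norm_le_norm_sub_add m k
    rw [norm_sub_rev] at this
    nlinarith [norm_nonneg (k - m), norm_nonneg k]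
  rcases le_total 0 s with hs | hs
  · rw [abs_of_nonneg hs, ← Real.mul_rpow (by positivity) (by positivity)]
    exact Real.rpow_le_rpow (by positivity) h1 hs
  · have h3 : (1 + ‖k‖) ^ s = ((1 + ‖k‖) ^ (-s))⁻¹ := by
      rw [Real.rpow_neg (by positivity), inv_inv]
    have h4 : (1 + ‖m‖) ^ s = ((1 + ‖m‖) ^ (-s))⁻¹ := by
      rw [Real.rpow_neg (by positivity), inv_inv]
    rw [abs_of_nonpos hs, h3, h4, ← div_eq_mul_inv, inv_le_comm₀ (by positivity) (by positivity),
      inv_div, div_le_iff₀ (by positivity), mul_comm, ← Real.mul_rpow (by positivity) (by positivity)]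
    exact Real.rpow_le_rpow (by positivity) h2 (by linarith)

end ScaledLattice

/-! ### Young's inequality -/

/-- Young's inequality `ℓ¹ * ℓ² ⊆ ℓ²` on a commutative group, with convolution by a function that
is at most one. -/
theorem summable_and_tsum_sq_conv_le {G : Type*} [AddCommGroup G] {φ g : G → ℝ}
    (hφ0 : ∀ x, 0 ≤ φ x) (hφ1 : ∀ x, φ x ≤ 1) (hg0 : ∀ x, 0 ≤ g x) (hφ : Summable φ)
    (hg : Summable fun x => g x ^ 2) :
    (∀ x, Summable fun y => φ (x - y) * g y) ∧
      (Summable fun x => (∑' y, φ (x - y) * g y) ^ 2) ∧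
      ∑' x, (∑' y, φ (x - y) * g y) ^ 2 ≤ (∑' x, φ x) ^ 2 * ∑' x, g x ^ 2 := by
  have hφs : ∀ x, Summable fun y => φ (x - y) := fun x =>
    (Equiv.subLeft x).summable_iff.2 hφ
  have hφt : ∀ x, ∑' y, φ (x - y) = ∑' y, φ y := fun x => (Equiv.subLeft x).tsum_eq φ
  have hs2 : ∀ x, Summable fun y => φ (x - y) * g y ^ 2 := fun x =>
    Summable.of_nonneg_of_le (fun y => mul_nonneg (hφ0 _) (sq_nonneg _))
      (fun y => mul_le_of_le_one_left (sq_nonneg _) (hφ1 _)) hg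
  have hs1 : ∀ x, Summable fun y => φ (x - y) * g y := fun x =>
    Summable.of_nonneg_of_le (fun y => mul_nonneg (hφ0 _) (hg0 _))
      (fun y => by nlinarith [hφ0 (x - y), sq_nonneg (g y - 1)]) ((hφs x).add (hs2 x))
  have hP : 0 ≤ ∑' x, φ x := tsum_nonneg hφ0
  -- Cauchy–Schwarz with weight `φ`, for `φ g = √φ · (√φ g)`: first on finite sets, then in the
  -- limit.
  have hcs : ∀ x, (∑' y, φ (x - y) * g y) ^ 2 ≤
      (∑' y, φ y) * ∑' y, φ (x - y) * g y ^ 2 := by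
    intro x
    have hQ : 0 ≤ ∑' y, φ (x - y) * g y ^ 2 :=
      tsum_nonneg fun y => mul_nonneg (hφ0 _) (sq_nonneg _)
    have h1 : ∀ u : Finset G, (∑ y ∈ u, φ (x - y) * g y) ^ 2 ≤
        (∑' y, φ y) * ∑' y, φ (x - y) * g y ^ 2 := by
      intro u
      refine (Finset.sum_sq_le_sum_mul_sum_of_sq_le_mul u (fun y _ => hφ0 (x - y))
        (fun y _ => mul_nonneg (hφ0 (x - y)) (sq_nonneg (g y))) (fun y _ => le_of_eq (by ring))).trans ?_
      rw [← hφt x]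
      exact mul_le_mul ((hφs x).sum_le_tsum u fun y _ => hφ0 _)
        ((hs2 x).sum_le_tsum u fun y _ => mul_nonneg (hφ0 _) (sq_nonneg _))
        (Finset.sum_nonneg fun y _ => mul_nonneg (hφ0 _) (sq_nonneg _))
        (tsum_nonneg fun y => hφ0 _)
    exact le_of_tendsto' ((hs1 x).hasSum.pow 2) h1
  have hprod : Summable fun p : G × G => φ p.1 * g p.2 ^ 2 :=
    hφ.mul_of_nonneg hg hφ0 fun y => sq_nonneg _
  -- This shear turns the double sum of the convolution into a product of two sums.
  let e : G × G ≃ G × G :=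
    { toFun := fun p => (p.1 - p.2, p.2)
      invFun := fun p => (p.1 + p.2, p.2)
      left_inv := fun p => by simp
      right_inv := fun p => by simp }
  have hprod' : Summable fun p : G × G => φ (p.1 - p.2) * g p.2 ^ 2 :=
    e.summable_iff.2 hprod
  have hval : ∑' x, ∑' y, φ (x - y) * g y ^ 2 = (∑' x, φ x) * ∑' x, g x ^ 2 := by
    rw [← hprod'.tsum_prod, hφ.tsum_mul_tsum hg hprod]
    exact e.tsum_eq fun p : G × G => φ p.1 * g p.2 ^ 2
  have hsum : Summable fun x => (∑' y, φ y) * ∑' y, φ (x - y) * g y ^ 2 :=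
    hprod'.prod.mul_left _
  have hres : Summable fun x => (∑' y, φ (x - y) * g y) ^ 2 :=
    Summable.of_nonneg_of_le (fun x => sq_nonneg _) hcs hsum
  refine ⟨hs1, hres, (hres.tsum_le_tsum hcs hsum).trans (le_of_eq ?_)⟩
  rw [tsum_mul_left, hval]
  ring

/-! ### Off-diagonal decay of the kernel -/

/-- Passing from `D^{(b)}` to `D^{(b+1)}` multiplies the integral by `-(x_j + ħb)`. As `|x_j| ≤ |x_j
+ ħb| + ħb`, one power of `|x_j|` costs one more derivative plus a term of lower moment; hence the
induction on `N` with `b` free. -/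
theorem IsLatticeSymbol.exists_moment_bound {n : ℕ} {h : ℝ} (hh : 0 < h) {r : ℝ}
    {σ : ScaledLattice n h → UnitAddTorus (Fin n) → ℂ} (hσ : IsLatticeSymbol r 0 0 σ)
    (j : Fin n) (N : ℕ) (b : ℕ) :
    ∃ C : ℝ, 0 ≤ C ∧ ∀ k x : ScaledLattice n h,
      |(x : EuclideanSpace ℝ (Fin n)) j| ^ N *
        ‖∫ θ, UnitAddTorus.mFourier (ScaledLattice.coord x) θ * SemiTorus.D h j b (σ k) θ ∂(torusMeasure n)‖ ≤
      C * (1 + ‖k‖) ^ r := by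
  induction N generalizing b with
  | zero =>
    obtain ⟨C, hC, hb⟩ := hσ.bound 0 (Pi.single j b)
    refine ⟨C, hC.le, fun k x => ?_⟩
    rw [pow_zero, one_mul]
    have h1 : ∀ θ, ‖UnitAddTorus.mFourier (ScaledLattice.coord x) θ * SemiTorus.D h j b (σ k) θ‖ ≤
        C * (1 + ‖k‖) ^ r := by
      intro θ
      have h2 := hb k θ
      simp only [ScaledLattice.multiDiff_zero, SemiTorus.multiD_single, zero_mul, sub_zero,
        add_zero] at h2
      rw [norm_mul]
      have h3 : ‖UnitAddTorus.mFourier (ScaledLattice.coord x) θ‖ = 1 := ScaledLattice.norm_char x θ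
      rwa [h3, one_mul]
    simpa using norm_integral_le_of_norm_le_const (μ := torusMeasure n)
      (Filter.Eventually.of_forall h1)
  | succ N ih =>
    obtain ⟨C₁, hC₁, h₁⟩ := ih (b + 1)
    obtain ⟨C₂, hC₂, h₂⟩ := ih b
    refine ⟨C₁ + h * b * C₂, by positivity, fun k x => ?_⟩
    have e₁ := h₁ k x
    have e₂ := h₂ k x
    rw [SemiTorus.integral_mFourier_mul_D_succ (hσ.smooth k), norm_mul, norm_neg] at e₁
    set I := ‖∫ θ, UnitAddTorus.mFourier (ScaledLattice.coord x) θ * SemiTorus.D h j b (σ k) θ ∂(torusMeasure n)‖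
    have hx : |(x : EuclideanSpace ℝ (Fin n)) j| ≤
        ‖(h * ScaledLattice.coord x j + h * b : ℂ)‖ + h * b := by
      rw [ScaledLattice.coord_spec, ← Real.norm_eq_abs, ← Complex.norm_real]
      have h3 := norm_sub_le (h * ScaledLattice.coord x j + h * b : ℂ) (h * b : ℂ)
      have h4 : ‖(h * b : ℂ)‖ = h * b := by simp [abs_of_pos hh]
      rw [h4, add_sub_cancel_right] at h3
      push_cast
      exact h3
    calc |(x : EuclideanSpace ℝ (Fin n)) j| ^ (N + 1) * I
        = |(x : EuclideanSpace ℝ (Fin n)) j| ^ N * I * |(x : EuclideanSpace ℝ (Fin n)) j| := by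
          ring
      _ ≤ |(x : EuclideanSpace ℝ (Fin n)) j| ^ N * I *
          (‖(h * ScaledLattice.coord x j + h * b : ℂ)‖ + h * b) := by gcongr
      _ = |(x : EuclideanSpace ℝ (Fin n)) j| ^ N * (‖(h * ScaledLattice.coord x j + h * b : ℂ)‖ * I) +
          h * b * (|(x : EuclideanSpace ℝ (Fin n)) j| ^ N * I) := by ring
      _ ≤ C₁ * (1 + ‖k‖) ^ r + h * b * (C₂ * (1 + ‖k‖) ^ r) :=
          add_le_add e₁ (mul_le_mul_of_nonneg_left e₂ (by positivity))
      _ = (C₁ + h * b * C₂) * (1 + ‖k‖) ^ r := by ring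

/-- The Schwartz kernel of `Op(σ)`. -/
def latticeKernel {n : ℕ} {h : ℝ} (σ : ScaledLattice n h → UnitAddTorus (Fin n) → ℂ)
    (k m : ScaledLattice n h) : ℂ :=
  ∫ θ, ScaledLattice.char (-m) θ * (ScaledLattice.char k θ * σ k θ) ∂(torusMeasure n)

theorem latticePairingTerm_eq {n : ℕ} {h : ℝ}
    (σ : ScaledLattice n h → UnitAddTorus (Fin n) → ℂ) (f : ScaledLattice n h → ℂ)
    (k m : ScaledLattice n h) :
    latticePairingTerm f (fun θ => ScaledLattice.char k θ * σ k θ) m =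
      f m * latticeKernel σ k m := rfl

theorem IsLatticeSymbol.exists_kernel_bound {n : ℕ} {h : ℝ} (hh : 0 < h) {r : ℝ}
    {σ : ScaledLattice n h → UnitAddTorus (Fin n) → ℂ} (hσ : IsLatticeSymbol r 0 0 σ) (N : ℕ) :
    ∃ C : ℝ, 0 ≤ C ∧ ∀ k m : ScaledLattice n h,
      ‖latticeKernel σ k m‖ ≤ C * (1 + ‖k‖) ^ r * (1 + ‖k - m‖)⁻¹ ^ N := by
  obtain ⟨A, hA, hA'⟩ := ScaledLattice.exists_pow_norm_le_sum n h N
  choose C hC hb using fun j => hσ.exists_moment_bound hh j N 0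
  obtain ⟨C₀, hC₀, hb₀⟩ := hσ.bound 0 0
  have hsup : ∀ k θ, ‖σ k θ‖ ≤ C₀ * (1 + ‖k‖) ^ r := by
    intro k θ
    have h2 := hb₀ k θ
    have h3 : SemiTorus.multiD h 0 (σ k) = σ k := by
      have key : ∀ L : List (Fin n),
          L.foldr (fun j G => SemiTorus.D h j ((0 : Fin n → ℕ) j) G) (σ k) = σ k := by
        intro L
        induction L with
        | nil => rfl
        | cons i L ih => simp [SemiTorus.D]
      exact key _
    simp only [ScaledLattice.multiDiff_zero, zero_mul, sub_zero, add_zero] at h2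
    rwa [h3] at h2
  -- `C₀` pays for the `1` in `1 + ∑ |x_j|^N`, each `C j` for the moment along its axis.
  refine ⟨A * (C₀ + ∑ j, C j), mul_nonneg hA (add_nonneg hC₀.le (Finset.sum_nonneg fun j _ => hC j)),
    fun k m => ?_⟩
  have hK : latticeKernel σ k m =
      ∫ θ, UnitAddTorus.mFourier (ScaledLattice.coord (k - m)) θ * σ k θ ∂(torusMeasure n) := by
    simp only [latticeKernel, ← mul_assoc, ScaledLattice.char_mul_char_neg hh.ne']
  have hK0 : ‖latticeKernel σ k m‖ ≤ C₀ * (1 + ‖k‖) ^ r := by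
    have h1 : ∀ θ, ‖UnitAddTorus.mFourier (ScaledLattice.coord (k - m)) θ * σ k θ‖ ≤ C₀ * (1 + ‖k‖) ^ r := by
      intro θ
      have h3 : ‖UnitAddTorus.mFourier (ScaledLattice.coord (k - m)) θ‖ = 1 := ScaledLattice.norm_char (k - m) θ
      rw [norm_mul, h3, one_mul]
      exact hsup k θ
    rw [hK]
    simpa using norm_integral_le_of_norm_le_const (μ := torusMeasure n)
      (Filter.Eventually.of_forall h1)
  rw [inv_pow, ← div_eq_mul_inv, le_div_iff₀ (by positivity), mul_comm]
  have hj : ∀ j, |((k - m : ScaledLattice n h) : EuclideanSpace ℝ (Fin n)) j| ^ N *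
      ‖latticeKernel σ k m‖ ≤ C j * (1 + ‖k‖) ^ r := fun j => by
    rw [hK]
    exact hb j k (k - m)
  calc (1 + ‖k - m‖) ^ N * ‖latticeKernel σ k m‖
      ≤ A * (1 + ∑ j, |((k - m : ScaledLattice n h) : EuclideanSpace ℝ (Fin n)) j| ^ N) *
        ‖latticeKernel σ k m‖ := by gcongr; exact hA' (k - m)
    _ = A * (‖latticeKernel σ k m‖ +
        ∑ j, |((k - m : ScaledLattice n h) : EuclideanSpace ℝ (Fin n)) j| ^ N *
          ‖latticeKernel σ k m‖) := by
        rw [← Finset.sum_mul]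
        ring
    _ ≤ A * (C₀ * (1 + ‖k‖) ^ r + ∑ j, C j * (1 + ‖k‖) ^ r) := by
        exact mul_le_mul_of_nonneg_left (add_le_add hK0 (Finset.sum_le_sum fun j _ => hj j)) hA
    _ = A * (C₀ + ∑ j, C j) * (1 + ‖k‖) ^ r := by
        rw [← Finset.sum_mul]
        ring

/-- After weighting, the kernel of `Op(σ)` is dominated by a summable convolution kernel. -/
theorem IsLatticeSymbol.exists_conv_bound {n : ℕ} {h : ℝ} (hh : 0 < h) {r : ℝ}
    {σ : ScaledLattice n h → UnitAddTorus (Fin n) → ℂ} (hσ : IsLatticeSymbol r 0 0 σ) (s : ℝ) :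
    ∃ (C : ℝ) (φ : ScaledLattice n h → ℝ), 0 ≤ C ∧ (∀ x, 0 ≤ φ x) ∧ (∀ x, φ x ≤ 1) ∧
      Summable φ ∧ ∀ k m, (1 + ‖k‖) ^ (s - r) * ‖latticeKernel σ k m‖ ≤
        C * (φ (k - m) * (1 + ‖m‖) ^ s) := by
  obtain ⟨N, hN⟩ := ScaledLattice.exists_summable_one_add_norm_inv_pow n hh
  -- Of the decay, `⌈|s|⌉₊` powers absorb the Peetre factor and `N` remain for summability.
  obtain ⟨C, hC, hK⟩ := hσ.exists_kernel_bound hh (⌈|s|⌉₊ + N)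
  refine ⟨C, fun x => (1 + ‖x‖)⁻¹ ^ N, hC, fun x => by positivity, fun x => ?_, hN, fun k m => ?_⟩
  · exact pow_le_one₀ (by positivity) (inv_le_one_of_one_le₀ (by linarith [norm_nonneg x]))
  have h1 : (1 + ‖k - m‖) ^ |s| * (1 + ‖k - m‖)⁻¹ ^ ⌈|s|⌉₊ ≤ 1 := by
    rw [inv_pow, ← div_eq_mul_inv, div_le_one (by positivity), ← Real.rpow_natCast]
    exact Real.rpow_le_rpow_of_exponent_le (by linarith [norm_nonneg (k - m)]) (Nat.le_ceil _)
  have hk : 0 < 1 + ‖k‖ := by positivity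
  calc (1 + ‖k‖) ^ (s - r) * ‖latticeKernel σ k m‖
      ≤ (1 + ‖k‖) ^ (s - r) * (C * (1 + ‖k‖) ^ r * (1 + ‖k - m‖)⁻¹ ^ (⌈|s|⌉₊ + N)) := by
        gcongr
        exact hK k m
    _ = C * (1 + ‖k - m‖)⁻¹ ^ (⌈|s|⌉₊ + N) * (1 + ‖k‖) ^ s := by
        rw [show (1 + ‖k‖) ^ s = (1 + ‖k‖) ^ (s - r) * (1 + ‖k‖) ^ r by
          rw [← Real.rpow_add hk, sub_add_cancel]]
        ring
    _ ≤ C * (1 + ‖k - m‖)⁻¹ ^ (⌈|s|⌉₊ + N) * ((1 + ‖k - m‖) ^ |s| * (1 + ‖m‖) ^ s) := by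
        gcongr
        exact ScaledLattice.one_add_norm_rpow_le k m s
    _ = C * (((1 + ‖k - m‖) ^ |s| * (1 + ‖k - m‖)⁻¹ ^ ⌈|s|⌉₊) *
          ((1 + ‖k - m‖)⁻¹ ^ N * (1 + ‖m‖) ^ s)) := by
        rw [pow_add]
        ring
    _ ≤ C * ((1 + ‖k - m‖)⁻¹ ^ N * (1 + ‖m‖) ^ s) := by
        exact mul_le_mul_of_nonneg_left (mul_le_of_le_one_left (by positivity) h1) hC

/-! ### Boundedness on weighted spaces and agreement with the integral -/

theorem weight_mul_sq {n : ℕ} {h : ℝ} (s : ℝ) (k : ScaledLattice n h) (z : ℂ) :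
    (1 + ‖k‖) ^ (2 * s) * ‖z‖ ^ 2 = ((1 + ‖k‖) ^ s * ‖z‖) ^ 2 := by
  rw [mul_pow, ← Real.rpow_mul_natCast (by positivity), mul_comm 2 s]
  norm_num

theorem IsLatticeSymbol.latticeOp_bound {n : ℕ} {h : ℝ} (hh : 0 < h) {r : ℝ}
    {σ : ScaledLattice n h → UnitAddTorus (Fin n) → ℂ} (hσ : IsLatticeSymbol r 0 0 σ) (s : ℝ) :
    ∃ B : ℝ, 0 ≤ B ∧ ∀ f ∈ weightedL2 n h s,
      (∀ k, Summable (latticePairingTerm f (fun θ => ScaledLattice.char k θ * σ k θ))) ∧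
      latticeOp σ f ∈ weightedL2 n h (s - r) ∧
      weightedL2Norm (s - r) (latticeOp σ f) ≤ B * weightedL2Norm s f := by
  obtain ⟨C, φ, hC, hφ0, hφ1, hφ, hK⟩ := hσ.exists_conv_bound hh s
  refine ⟨C * ∑' x, φ x, mul_nonneg hC (tsum_nonneg hφ0), fun f hf => ?_⟩
  have hf' : Summable fun m => ((1 + ‖m‖) ^ s * ‖f m‖) ^ 2 :=
    Summable.congr hf fun m => weight_mul_sq s m (f m)
  obtain ⟨hc, hcs, hct⟩ := summable_and_tsum_sq_conv_le hφ0 hφ1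
    (fun m => by positivity : ∀ m : ScaledLattice n h, 0 ≤ (1 + ‖m‖) ^ s * ‖f m‖) hφ hf'
  have hterm : ∀ k m, (1 + ‖k‖) ^ (s - r) *
      ‖latticePairingTerm f (fun θ => ScaledLattice.char k θ * σ k θ) m‖ ≤
      C * (φ (k - m) * ((1 + ‖m‖) ^ s * ‖f m‖)) := by
    intro k m
    rw [latticePairingTerm_eq, norm_mul]
    have := mul_le_mul_of_nonneg_right (hK k m) (norm_nonneg (f m))
    linarith
  have hws : ∀ k, Summable fun m => (1 + ‖k‖) ^ (s - r) *
      ‖latticePairingTerm f (fun θ => ScaledLattice.char k θ * σ k θ) m‖ := fun k =>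
    Summable.of_nonneg_of_le (fun m => by positivity) (hterm k) ((hc k).mul_left C)
  -- For fixed `k` the weight is a positive constant and can be dropped.
  have hns : ∀ k, Summable fun m =>
      ‖latticePairingTerm f (fun θ => ScaledLattice.char k θ * σ k θ) m‖ := fun k =>
    (summable_mul_left_iff (by positivity)).1 (hws k)
  have hop : ∀ k, (1 + ‖k‖) ^ (2 * (s - r)) * ‖latticeOp σ f k‖ ^ 2 ≤
      C ^ 2 * (∑' m, φ (k - m) * ((1 + ‖m‖) ^ s * ‖f m‖)) ^ 2 := by
    intro k
    rw [weight_mul_sq, ← mul_pow]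
    refine pow_le_pow_left₀ (by positivity) ?_ 2
    calc (1 + ‖k‖) ^ (s - r) * ‖latticeOp σ f k‖
        ≤ (1 + ‖k‖) ^ (s - r) *
          ∑' m, ‖latticePairingTerm f (fun θ => ScaledLattice.char k θ * σ k θ) m‖ := by
          gcongr
          exact norm_tsum_le_tsum_norm (hns k)
      _ ≤ C * ∑' m, φ (k - m) * ((1 + ‖m‖) ^ s * ‖f m‖) := by
          rw [← tsum_mul_left, ← tsum_mul_left]
          exact (hws k).tsum_le_tsum (hterm k) ((hc k).mul_left C)
  -- A divergent `tsum` has value `0`, so summability has to be known before the norms are compared.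
  have hmem : Summable fun k => (1 + ‖k‖) ^ (2 * (s - r)) * ‖latticeOp σ f k‖ ^ 2 :=
    Summable.of_nonneg_of_le (fun k => by positivity) hop (hcs.mul_left _)
  refine ⟨fun k => (hns k).of_norm, hmem, ?_⟩
  have hP : 0 ≤ C * ∑' x, φ x := mul_nonneg hC (tsum_nonneg hφ0)
  unfold weightedL2Norm
  rw [← Real.sqrt_sq hP, ← Real.sqrt_mul (sq_nonneg _)]
  refine Real.sqrt_le_sqrt ((hmem.tsum_le_tsum hop (hcs.mul_left _)).trans ?_)
  simp_rw [weight_mul_sq s]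
  rw [tsum_mul_left, mul_pow, mul_assoc]
  gcongr

/-- For `f ∈ ℓ¹` the Fourier series converges uniformly because characters have modulus one. The
integrand is therefore continuous on a compact space, and sum and integral may be exchanged. -/
theorem latticeOp_eq_latticeOpInt {n : ℕ} {h : ℝ}
    {σ : ScaledLattice n h → UnitAddTorus (Fin n) → ℂ} {k : ScaledLattice n h}
    (hσ : Continuous (σ k)) {f : ScaledLattice n h → ℂ} (hf : Summable fun k => ‖f k‖) :
    Integrable (fun θ => ScaledLattice.char k θ * σ k θ * latticeFourier f θ)
        (torusMeasure n) ∧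
      latticeOp σ f k = latticeOpInt σ f k := by
  have hφ : Continuous fun θ => ScaledLattice.char k θ * σ k θ :=
    (ScaledLattice.continuous_char k).mul hσ
  have hF : Continuous (latticeFourier f) :=
    continuous_tsum (fun m => (ScaledLattice.continuous_char (-m)).mul continuous_const) hf
      fun m θ => by rw [norm_mul, ScaledLattice.norm_char, one_mul]
  refine ⟨SemiTorus.integrable_of_continuous (hφ.mul hF), ?_⟩
  have hi : ∀ m, Integrable (fun θ => f m *
      (ScaledLattice.char (-m) θ * (ScaledLattice.char k θ * σ k θ))) (torusMeasure n) := fun m =>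
    SemiTorus.integrable_of_continuous
      (continuous_const.mul ((ScaledLattice.continuous_char (-m)).mul hφ))
  have hn : Summable fun m => ∫ θ, ‖f m *
      (ScaledLattice.char (-m) θ * (ScaledLattice.char k θ * σ k θ))‖ ∂(torusMeasure n) := by
    simp_rw [norm_mul, ScaledLattice.norm_char, one_mul, integral_const_mul]
    exact hf.mul_right _
  have h1 := integral_tsum_of_summable_integral_norm hi hn
  unfold latticeOp latticeOpInt latticePairingTerm
  simp_rw [integral_const_mul] at h1
  rw [h1]
  refine integral_congr_ae (Filter.Eventually.of_forall fun θ => ?_)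
  simp only [latticeFourier, ← tsum_mul_left]
  exact tsum_congr fun m => by ring

end

theorem mainTheorem8(n : ℕ) (h : ℝ) (h_pos : 0 < h) (h_le : h ≤ 1) (r : ℝ)
    (σ : ScaledLattice n h → UnitAddTorus (Fin n) → ℂ)
    (hσ : IsLatticeSymbol r 0 0 σ) (s : ℝ) :
    -- `Op(σ)f` is well defined for `f ∈ ℓ²_s`, by an absolutely convergent pairing
    (∀ f ∈ weightedL2 n h s, ∀ k, Summable
      (latticePairingTerm f (fun θ => ScaledLattice.char k θ * σ k θ))) ∧
    -- on absolutely summable `f` it is the defining integral, which converges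
    (∀ f : ScaledLattice n h → ℂ, Summable (fun k => ‖f k‖) → ∀ k,
      Integrable (fun θ => ScaledLattice.char k θ * σ k θ * latticeFourier f θ)
        (torusMeasure n) ∧
      latticeOp σ f k = latticeOpInt σ f k) ∧
    -- and it is a bounded linear operator from `ℓ²_s` to `ℓ²_{s-r}`
    ∃ T : weightedL2 n h s →ₗ[ℂ] weightedL2 n h (s - r),
      (∀ f k, (T f : ScaledLattice n h → ℂ) k = latticeOp σ f k) ∧
      ∃ C : ℝ, ∀ f, weightedL2Norm (s - r) (T f : ScaledLattice n h → ℂ) ≤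
        C * weightedL2Norm s (f : ScaledLattice n h → ℂ) := by
  obtain ⟨B, _, hB⟩ := hσ.latticeOp_bound h_pos s
  refine ⟨fun f hf => (hB f hf).1,
    fun f hf k => latticeOp_eq_latticeOpInt (hσ.smooth k).continuous hf,
    { toFun := fun f => ⟨latticeOp σ f, (hB f f.2).2.1⟩
      map_add' := fun f g => Subtype.ext (funext fun k => ?_)
      map_smul' := fun c f => Subtype.ext (funext fun k => ?_) },
    fun f k => rfl, B, fun f => (hB f f.2).2.2⟩
  -- Additivity splits a series and so uses convergence of both parts; homogeneity below holds for
  -- `tsum` unconditionally.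
  · exact (tsum_congr fun m => add_mul (f.1 m) (g.1 m) _).trans
      (((hB f f.2).1 k).tsum_add ((hB g g.2).1 k))
  · exact (tsum_congr fun m => mul_assoc c (f.1 m) _).trans tsum_mul_left
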